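/- Let $\mathbb K$ be a field of characteristic $0$, let $\mathcal I$ be a finite set (say $|\mathcal I|=t$), and let $d=(d_x)_{x\in\mathcal I}$ be non-negative integers. Let $D_d$ be the derivation of $\mathbb K[\mathcal I,d]:=\mathbb K[x_i \mid x\in\mathcal I,\ 0\le i\le d_x]$ with $D_d(x_0)=0$ and $D_d(x_i)=x_{i-1}$ for $i\ge 1$; the polynomials of multidegree $m=(m_x)_{x\in\mathcal I}$ are those that, for each $x$, are homogeneous of degree $m_x$ in $x_0,\dots,x_{d_x}$. Let $\mathcal J$ be a finite set of symbol letters, divided by a map $\varphi:\mathcal J\to\mathcal I$ into classes $\mathcal J_x=\varphi^{-1}(x)$, and put $m_x=|\mathcal J_x|$. (If the $d_x$ are pairwise distinct, two letters $\alpha,\beta$ lie in one class exactly when $d_{\varphi(\alpha)}=d_{\varphi(\beta)}$.) Let $\mathrm{Sym}(V_{\mathcal J})=\mathbb K[\alpha_0,\alpha_1\mid\alpha\in\mathcal J]$ with the derivation $D$ given by $D(\alpha_0)=0$, $D(\alpha_1)=\alpha_0$. The one-dimensional Lie algebra $\mathfrak u_2$ acts through $D$ on $\mathrm{Sym}(V_{\mathcal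 J})$ and through $D_d$ on $\mathbb K[\mathcal I,d]$, and $\mathrm{Sym}(V_{\mathcal J})^{\mathfrak u_2}=\ker D$. The component of weight $d^m$, written $(\cdot)_{d^m}$, consists of the polynomials that, for each $\alpha\in\mathcal J$, are homogeneous of degree $d_{\varphi(\alpha)}$ in $\alpha_0,\alpha_1$. Let $\mathrm{Sym}_{\mathcal J}=\mathbb K[x_{\alpha,\beta},x_\gamma\mid \alpha,\beta,\gamma\in\mathcal J,\ \alpha\ne\beta]$ be the free polynomial algebra on bracket symbols, graded by weight, where $x_{\alpha,\beta}$ has degree $1$ in $\alpha$ and in $\beta$, and $x_\gamma$ has degree $1$ in $\gamma$. Let $\chi:\mathrm{Sym}_{\mathcal J}\to\mathrm{Sym}(V_{\mathcal J})^{\mathfrak u_2}$ be the algebra homomorphism with $\chi(x_{\alpha,\beta})=\alpha_0\beta_1-\alpha_1\beta_0$ and $\chi(x_\gamma)=\gamma_0$. Permutations $\sigma$ of $\mathcal J$ act on $\mathrm{Sym}_{\mathcal J}$ by $\sigma x_{\alpha,\beta}=x_{\sigma\alpha,\sigma\beta}$, $\sigma x_\gamma=x_{\sigma\gamma}$. Then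 there is a $\mathfrak u_2$-equivariant linear map $\Lambda$ from $\mathrm{Sym}(V_{\mathcal J})_{d^m}$ to the component of $\mathbb K[\mathcal I,d]$ of multidegree $m$, given on monomials by $$\Lambda\Bigl(\prod_{\alpha\in\mathcal J}\alpha_0^{d_{\varphi(\alpha)}-i_\alpha}\alpha_1^{i_\alpha}\Bigr)=\prod_{\alpha\in\mathcal J} i_\alpha!\,\varphi(\alpha)_{i_\alpha}\qquad(0\le i_\alpha\le d_{\varphi(\alpha)}),$$ which restricts to a surjective linear map $$\Lambda:\bigl(\mathrm{Sym}(V_{\mathcal J})^{\mathfrak u_2}\bigr)_{d^m}\to(\ker D_d)_m .$$ Moreover the composition $\Lambda\circ\chi:(\mathrm{Sym}_{\mathcal J})_{d^m}\to(\ker D_d)_m$ is surjective, and $$\ker(\Lambda\circ\chi)=(\ker\chi)_{d^m}+\bigl\langle P-\sigma P \;\bigm|\; P\in(\mathrm{Sym}_{\mathcal J})_{d^m},\ \sigma\in S_{\mathcal J_x},\ x\in\mathcal I\bigr\rangle ,$$ where $S_{\mathcal J_x}$ is the group of permutations of $\mathcal J$ that fix every letter outside $\mathcal J_x$. -/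

import Mathlib

namespace Weitzenboeck

open MvPolynomial

/-- The variables `x_0, …, x_{d x}` attached to each letter `x ∈ I`, so that
`MvPolynomial (JordanVar d) K` is `Sym (⨁ x, V_{x, d x})`. -/
abbrev JordanVar {I : Type*} (d : I → ℕ) : Type _ := (x : I) × Fin (d x + 1)

/-- The Weitzenböck derivation `D_d`: `D (x_0) = 0` and `D (x_i) = x_{i-1}` for `i > 0`.
It is the action of the generator `e` of `𝔲₂`. -/
noncomputable def weitzenboeck (K : Type*) [Field K] {I : Type*} (d : I → ℕ) :
    Derivation K (MvPolynomial (JordanVar d) K) (MvPolynomial (JordanVar d) K) :=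
  mkDerivation K fun p =>
    if p.2 = 0 then 0 else X ⟨p.1, ⟨p.2.val - 1, lt_of_le_of_lt (Nat.sub_le _ _) p.2.isLt⟩⟩

/-- The component of multidegree `m` of `Sym (⨁ x, V_{x, d x})`: the polynomials which, for every
letter `x`, are homogeneous of degree `m x` in the variables `x_0, …, x_{d x}`. -/
noncomputable def multidegree (K : Type*) [Field K] {I : Type*} [DecidableEq I]
    (d : I → ℕ) (m : I → ℕ) : Submodule K (MvPolynomial (JordanVar d) K) :=
  weightedHomogeneousSubmodule K (fun p : JordanVar d => (Pi.single p.1 1 : I → ℕ)) m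

/-- The semi-invariants (kernel of `D_d`) of multidegree `m`. -/
noncomputable def semiInvariants (K : Type*) [Field K] {I : Type*} [DecidableEq I]
    (d : I → ℕ) (m : I → ℕ) : Submodule K (MvPolynomial (JordanVar d) K) :=
  multidegree K d m ⊓ LinearMap.ker (weitzenboeck K d).toLinearMap

/-- `D_d` preserves multidegrees. -/
theorem weitzenboeck_mem (K : Type*) [Field K] {I : Type*} [DecidableEq I]
    (d m : I → ℕ) (P : MvPolynomial (JordanVar d) K) (hP : P ∈ multidegree K d m) :
    weitzenboeck K d P ∈ multidegree K d m := by
  classical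
  rw [P.as_sum, map_sum]
  refine Submodule.sum_mem _ fun s hs => ?_
  have hw := hP (mem_support_iff.mp hs)
  rw [weitzenboeck, mkDerivation_monomial]
  refine Submodule.smul_mem _ _ (Submodule.sum_mem _ fun p hp => ?_)
  dsimp only
  split_ifs with h
  · simp
  · have hp1 : 1 ≤ s p := Nat.one_le_iff_ne_zero.mpr (Finsupp.mem_support_iff.mp hp)
    have hle : Finsupp.single p 1 ≤ s := by simpa using hp1
    have h1 : IsWeightedHomogeneous (fun p : JordanVar d => (Pi.single p.1 1 : I → ℕ))
        (monomial (s - Finsupp.single p 1) ((s p : ℕ) : K))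
        (Finsupp.weight (fun p : JordanVar d => (Pi.single p.1 1 : I → ℕ))
          (s - Finsupp.single p 1)) := isWeightedHomogeneous_monomial _ _ _ rfl
    have h2 := h1.mul (isWeightedHomogeneous_X K
        (fun p : JordanVar d => (Pi.single p.1 1 : I → ℕ))
        ⟨p.1, ⟨p.2.val - 1, lt_of_le_of_lt (Nat.sub_le _ _) p.2.isLt⟩⟩)
    have h3 : Finsupp.weight (fun p : JordanVar d => (Pi.single p.1 1 : I → ℕ))
          (s - Finsupp.single p 1) + Pi.single p.1 1 = m := by
      rw [← hw]
      conv_rhs => rw [← tsub_add_cancel_of_le hle]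
      rw [map_add, Finsupp.weight_single, one_smul]
    rw [smul_eq_mul]
    exact h3 ▸ h2

/-- `D_d` as an endomorphism of the component of multidegree `m`. -/
noncomputable def weitzenboeckOn (K : Type*) [Field K] {I : Type*} [DecidableEq I]
    (d m : I → ℕ) : multidegree K d m →ₗ[K] multidegree K d m :=
  (weitzenboeck K d).toLinearMap.restrict (weitzenboeck_mem K d m)

/-- The tuple `(1, …, 1)`: `MvPolynomial (JordanVar (ones J)) K` is `Sym (V_J)`, the polynomial
algebra in the variables `α_0, α_1` for `α ∈ J`; its multidegree is the weight. -/
abbrev ones (J : Type*) : J → ℕ := fun _ => 1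

/-- The variable `α_i` of `Sym (V_J)`, `i = 0, 1`. -/
noncomputable def letter (K : Type*) [Field K] {J : Type*} (α : J) (i : Fin 2) :
    MvPolynomial (JordanVar (ones J)) K := X ⟨α, i⟩

/-- The bracket `[α, β] = α_0 β_1 - α_1 β_0`. -/
noncomputable def bracket (K : Type*) [Field K] {J : Type*} (α β : J) :
    MvPolynomial (JordanVar (ones J)) K :=
  letter K α 0 * letter K β 1 - letter K α 1 * letter K β 0

/-- The free bracket symbols: `x_{α,β}` for `α ≠ β`, and `x_γ`. -/
inductive BracketVar (J : Type*)
  | pair (α β : J) (h : α ≠ β) : BracketVar J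
  | single (γ : J) : BracketVar J

/-- The action of a permutation of the letters on the bracket symbols. -/
def BracketVar.perm {J : Type*} (σ : Equiv.Perm J) : BracketVar J → BracketVar J
  | .pair α β h => .pair (σ α) (σ β) (σ.injective.ne h)
  | .single γ => .single (σ γ)

/-- The weight of a bracket symbol: how often each letter occurs in it. -/
def BracketVar.weight {J : Type*} [DecidableEq J] : BracketVar J → (J → ℕ)
  | .pair α β _ => Pi.single α 1 + Pi.single β 1
  | .single γ => Pi.single γ 1

/-- The component of weight `w` of the free algebra `Sym_J` on the bracket symbols. -/
noncomputable def bracketComponent (K : Type*) [Field K] {J : Type*} [DecidableEq J] (w : J → ℕ) :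
    Submodule K (MvPolynomial (BracketVar J) K) :=
  weightedHomogeneousSubmodule K BracketVar.weight w

/-- The value of `χ` on a bracket symbol. -/
noncomputable def chiVar (K : Type*) [Field K] {J : Type*} :
    BracketVar J → MvPolynomial (JordanVar (ones J)) K
  | .pair α β _ => bracket K α β
  | .single γ => letter K γ 0

/-- The algebra map `χ` with `χ (x_{α,β}) = [α, β]` and `χ (x_γ) = γ_0`. -/
noncomputable def chi (K : Type*) [Field K] (J : Type*) :
    MvPolynomial (BracketVar J) K →ₐ[K] MvPolynomial (JordanVar (ones J)) K :=
  aeval (chiVar K)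

theorem letter_mem (K : Type*) [Field K] {J : Type*} [DecidableEq J] (α : J) (i : Fin 2) :
    letter K α i ∈ multidegree K (ones J) (Pi.single α 1) :=
  isWeightedHomogeneous_X K (fun p : JordanVar (ones J) => (Pi.single p.1 1 : J → ℕ)) ⟨α, i⟩

theorem weitzenboeck_letter_zero (K : Type*) [Field K] {J : Type*} (α : J) :
    weitzenboeck K (ones J) (letter K α 0) = 0 := by
  simp [weitzenboeck, letter, mkDerivation_X]

theorem weitzenboeck_letter_one (K : Type*) [Field K] {J : Type*} (α : J) :
    weitzenboeck K (ones J) (letter K α 1) = letter K α 0 := by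
  simp [weitzenboeck, letter, mkDerivation_X]

theorem chiVar_mem (K : Type*) [Field K] {J : Type*} [DecidableEq J] (v : BracketVar J) :
    chiVar K v ∈ semiInvariants K (ones J) v.weight := by
  cases v with
  | pair α β h =>
    refine ⟨Submodule.sub_mem _ ?_ ?_, ?_⟩
    · exact IsWeightedHomogeneous.mul (letter_mem K α 0) (letter_mem K β 1)
    · exact IsWeightedHomogeneous.mul (letter_mem K α 1) (letter_mem K β 0)
    · change weitzenboeck K (ones J) (bracket K α β) = 0
      simp only [bracket, map_sub, Derivation.leibniz, weitzenboeck_letter_zero,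
        weitzenboeck_letter_one, smul_eq_mul]
      ring
  | single γ => exact ⟨letter_mem K γ 0, weitzenboeck_letter_zero K γ⟩

theorem weitzenboeck_chi (K : Type*) [Field K] {J : Type*} (P : MvPolynomial (BracketVar J) K) :
    weitzenboeck K (ones J) (chi K J P) = 0 := by
  classical
  induction P using MvPolynomial.induction_on with
  | C a =>
    rw [chi, aeval_C]
    exact Derivation.map_algebraMap _ a
  | add p q hp hq => rw [map_add, map_add, hp, hq, add_zero]
  | mul_X p v hp =>
    have hv : weitzenboeck K (ones J) (chiVar K v) = 0 := (chiVar_mem K v).2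
    have hX : chi K J (X v) = chiVar K v := aeval_X _ _
    rw [map_mul, Derivation.leibniz, hp, hX, hv, smul_zero, smul_zero, add_zero]

/-- `χ` maps the component of weight `w` to semi-invariants of weight `w`. -/
theorem chi_mem (K : Type*) [Field K] {J : Type*} [DecidableEq J] (w : J → ℕ)
    (P : MvPolynomial (BracketVar J) K) (hP : P ∈ bracketComponent K w) :
    chi K J P ∈ semiInvariants K (ones J) w := by
  constructor
  · rw [P.as_sum, map_sum]
    refine Submodule.sum_mem _ fun s hs => ?_
    rw [chi, aeval_monomial]
    have hw := hP (mem_support_iff.mp hs)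
    rw [← Algebra.smul_def, ← hw]
    refine Submodule.smul_mem _ _ ?_
    rw [Finsupp.weight_apply]
    exact IsWeightedHomogeneous.prod _ _ _ fun v _ => (chiVar_mem K v).1.pow _
  · exact weitzenboeck_chi K P

/-- `χ` from the component of weight `w` of `Sym_J` to the semi-invariants of weight `w`. -/
noncomputable def chiOn (K : Type*) [Field K] {J : Type*} [DecidableEq J] (w : J → ℕ) :
    bracketComponent K w →ₗ[K] semiInvariants K (ones J) w :=
  (chi K J).toLinearMap.restrict (chi_mem K w)

/-- The product over all letters `α` of `α_0 ^ (w α - e α) * α_1 ^ e α`. -/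
noncomputable def letterMonomial (K : Type*) [Field K] {J : Type*} [Fintype J]
    (w e : J → ℕ) : MvPolynomial (JordanVar (ones J)) K :=
  ∏ α, letter K α 0 ^ (w α - e α) * letter K α 1 ^ e α

theorem letterMonomial_mem (K : Type*) [Field K] {J : Type*} [Fintype J] [DecidableEq J]
    (w e : J → ℕ) (he : ∀ α, e α ≤ w α) : letterMonomial K w e ∈ multidegree K (ones J) w := by
  have h : IsWeightedHomogeneous
      (fun p : JordanVar (ones J) => (Pi.single p.1 1 : J → ℕ)) (letterMonomial K w e)
      (∑ α, ((w α - e α) • (Pi.single α 1 : J → ℕ) + e α • (Pi.single α 1 : J → ℕ))) :=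
    IsWeightedHomogeneous.prod _ _ _ fun α _ =>
      IsWeightedHomogeneous.mul (IsWeightedHomogeneous.pow (letter_mem K α 0) _)
        (IsWeightedHomogeneous.pow (letter_mem K α 1) _)
  have hs : (∑ α, ((w α - e α) • (Pi.single α 1 : J → ℕ) + e α • (Pi.single α 1 : J → ℕ))) = w := by
    funext β
    simp [Finset.sum_apply, Pi.single_apply, Nat.sub_add_cancel (he β), ← add_mul]
  rw [hs] at h
  exact h

/-- The size `m_x` of the class of symbol letters labelled by `x`. -/
def classSize {J I : Type*} [Fintype J] [DecidableEq I] (cls : J → I) (x : I) : ℕ :=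
  Fintype.card {α : J // cls α = x}

end Weitzenboeck

/-! The proof combines a first fundamental theorem for `𝔲₂` with averaging over the group `G` of
class-preserving permutations of the letters.

Brackets and the `α_0` generate `ker D` (`mem_range_chi`). If `D P = 0` and `P` has degree `a` in
the `α_0` and `b` in the `α_1`, then `∑ [α,β] Ω_{αβ} P = 2b(a+1) P`, where `Ω` is Cayley's process
(`sum_bracket_mul_cayley`). Since `Ω` preserves `ker D` and lowers the degree by two, induction
expresses `P` through brackets as soon as `b ≠ 0`.

In weight `d^m`, `Λ` sends monomials to nonzero multiples of monomials, reaches all those of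
multidegree `m`, and identifies two exactly when `G` exchanges them. So it is `G`-invariant,
surjective, and in characteristic 0 injective on `G`-invariants (`eq_zero_of_symbolicMap_eq_zero`).
The factor `i!` makes both derivations lower indices by the same rule, hence equivariance.

Both remaining claims follow by averaging. If `Λ P` is a semi-invariant and `A` is the `G`-sum of
`P`, then `D A` is `G`-invariant and `Λ` kills it, so `D A = 0`. If `Λ (χ P) = 0`, the `G`-sum of `χ
P` vanishes likewise, and `|G| P = ∑ σP + ∑ (P - σP)` splits `P` as required. -/

namespace Weitzenboeck

open MvPolynomial

/-! ### Weighted homogeneous components and partial derivatives -/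

section WeightedHomogeneous

variable {R σ τ M N : Type*} [CommSemiring R] [AddCommMonoid M] [AddCommMonoid N]

/-- A linear map that shifts weights injectively commutes with taking homogeneous components. -/
theorem weightedHomogeneousComponent_map {w : σ → M} {w' : τ → N} {f : M → N}
    (hf : Function.Injective f) (T : MvPolynomial σ R →ₗ[R] MvPolynomial τ R)
    (hT : ∀ n P, IsWeightedHomogeneous w P n → IsWeightedHomogeneous w' (T P) (f n))
    (n : M) (P : MvPolynomial σ R) :
    weightedHomogeneousComponent w' (f n) (T P) = T (weightedHomogeneousComponent w n P) := by
  classical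
  induction P using MvPolynomial.induction_on' with
  | add p q hp hq => simp only [map_add, hp, hq]
  | monomial s a =>
    have hs := isWeightedHomogeneous_monomial (R := R) w s a rfl
    by_cases h : n = Finsupp.weight w s
    · rw [h, (hT _ _ hs).weightedHomogeneousComponent_same, hs.weightedHomogeneousComponent_same]
    · rw [(hT _ _ hs).weightedHomogeneousComponent_ne _ (hf.ne h),
        hs.weightedHomogeneousComponent_ne _ h, map_zero]

/-- Membership in a submodule can be tested on homogeneous components. -/
theorem mem_of_weightedHomogeneousComponent_mem (w : σ → M) {A : Submodule R (MvPolynomial σ R)}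
    {P : MvPolynomial σ R} (h : ∀ n, weightedHomogeneousComponent w n P ∈ A) : P ∈ A := by
  rw [← sum_weightedHomogeneousComponent w P,
    finsum_eq_sum _ (weightedHomogeneousComponent_finsupp P)]
  exact Submodule.sum_mem _ fun n _ => h n

theorem isWeightedHomogeneous_rename {w : σ → M} {w' : τ → N} (φ : M →+ N) (f : σ → τ)
    (hf : ∀ i, w' (f i) = φ (w i)) {n : M} {P : MvPolynomial σ R}
    (hP : IsWeightedHomogeneous w P n) : IsWeightedHomogeneous w' (rename f P) (φ n) := by
  intro s hs
  obtain ⟨u, rfl, hu⟩ := coeff_rename_ne_zero f P s hs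
  rw [← hP hu, Finsupp.weight_apply, Finsupp.weight_apply, map_finsuppSum,
    Finsupp.sum_mapDomain_index (h := fun i c => c • w' i) (fun _ => zero_smul ℕ _)
      fun _ _ _ => add_smul _ _ _]
  simp only [hf, map_nsmul]

theorem isWeightedHomogeneous_map_weight {w : σ → M} (φ : M →+ N) {n : M} {P : MvPolynomial σ R}
    (hP : IsWeightedHomogeneous w P n) :
    IsWeightedHomogeneous (fun i => φ (w i)) P (φ n) := by
  simpa using isWeightedHomogeneous_rename φ id (w' := fun i => φ (w i)) (fun _ => rfl) hP

theorem weight_eq_sum [Fintype σ] (w : σ → M) (s : σ →₀ ℕ) :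
    Finsupp.weight w s = ∑ i, s i • w i := by
  rw [Finsupp.weight_apply]
  exact Finsupp.sum_fintype _ _ fun _ => zero_smul ℕ _

theorem weight_of_coeff_pderiv_ne_zero {w : σ → M} {n : M} {P : MvPolynomial σ R}
    (hP : IsWeightedHomogeneous w P n) {i : σ} {s : σ →₀ ℕ} (hs : coeff s (pderiv i P) ≠ 0) :
    Finsupp.weight w s + w i = n := by
  rw [coeff_pderiv] at hs
  have := hP (left_ne_zero_of_mul hs)
  rwa [map_add, Finsupp.weight_single, one_smul] at this

/-- Truncated subtraction is harmless: any monomial that survives in the derivative has a weight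
which, increased by `w i`, gives `n`; otherwise the derivative is zero. -/
theorem isWeightedHomogeneous_pderiv_sub {M : Type*} [AddCommMonoid M] [PartialOrder M]
    [Sub M] [OrderedSub M] [AddLeftReflectLE M] [CanonicallyOrderedAdd M]
    {w : σ → M} {n : M} {P : MvPolynomial σ R}
    (hP : IsWeightedHomogeneous w P n) (i : σ) :
    IsWeightedHomogeneous w (pderiv i P) (n - w i) := fun s hs => by
  rw [← weight_of_coeff_pderiv_ne_zero hP hs, add_tsub_cancel_right]

theorem isWeightedHomogeneous_X_mul_pderiv {w : σ → M} {n : M} {P : MvPolynomial σ R}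
    (hP : IsWeightedHomogeneous w P n) {i j : σ} {δ : M} (hij : w j = w i + δ) :
    IsWeightedHomogeneous w (X j * pderiv i P) (n + δ) := by
  classical
  intro s hs
  rw [coeff_X_mul'] at hs
  split_ifs at hs with h
  · have h1 := weight_of_coeff_pderiv_ne_zero hP hs
    have hle : Finsupp.single j 1 ≤ s := by
      simpa [Nat.one_le_iff_ne_zero] using h
    rw [← tsub_add_cancel_of_le hle, map_add, Finsupp.weight_single, one_smul, hij, ← h1, add_assoc]
  · exact absurd rfl hs

end WeightedHomogeneous

theorem derivation_sum_apply {R A M ι : Type*} [CommSemiring R] [CommSemiring A] [AddCommMonoid M]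
    [Algebra R A] [Module A M] [Module R M] (s : Finset ι) (D : ι → Derivation R A M) (a : A) :
    (∑ i ∈ s, D i) a = ∑ i ∈ s, D i a := by
  have h := map_sum (Derivation.coeFnAddMonoidHom (R := R) (A := A) (M := M)) D s
  exact (congrFun h a).trans (Finset.sum_apply _ _ _)

/-- The commutator of two derivations is a derivation, and this one kills every variable. -/
theorem pderiv_pderiv_comm {R σ : Type*} [CommRing R] (i j : σ) (P : MvPolynomial σ R) :
    pderiv i (pderiv j P) = pderiv j (pderiv i P) := by
  classical
  have h : ⁅pderiv (R := R) i, pderiv j⁆ = 0 := derivation_ext fun k => by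
    rw [Derivation.commutator_apply, pderiv_X, pderiv_X, Pi.single_apply, Pi.single_apply]
    split_ifs <;> simp
  have h2 := congrArg (fun D => D P) h
  simpa [Derivation.commutator_apply, sub_eq_zero] using h2

/-! ### Cayley's process and the Gordan-Capelli identity -/

section FirstFundamentalTheorem

variable (K : Type*) [Field K] {J : Type*}

/-- The partial derivative with respect to `α_i`. -/
noncomputable def letterDeriv (α : J) (i : Fin 2) :
    Derivation K (MvPolynomial (JordanVar (ones J)) K) (MvPolynomial (JordanVar (ones J)) K) :=
  pderiv (⟨α, i⟩ : JordanVar (ones J))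

/-- Cayley's process `∂/∂α_0 ∂/∂β_1 - ∂/∂α_1 ∂/∂β_0`. -/
noncomputable def cayley (α β : J) (P : MvPolynomial (JordanVar (ones J)) K) :
    MvPolynomial (JordanVar (ones J)) K :=
  letterDeriv K α 0 (letterDeriv K β 1 P) - letterDeriv K α 1 (letterDeriv K β 0 P)

theorem letterDeriv_comm (α β : J) (i j : Fin 2) (P : MvPolynomial (JordanVar (ones J)) K) :
    letterDeriv K α i (letterDeriv K β j P) = letterDeriv K β j (letterDeriv K α i P) :=
  pderiv_pderiv_comm _ _ P

variable [DecidableEq J]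

theorem letterDeriv_letter (α β : J) (i j : Fin 2) :
    letterDeriv K α i (letter K β j) = if α = β ∧ i = j then 1 else 0 := by
  classical
  rw [letterDeriv, letter, pderiv_X, Pi.single_apply]
  have : ((⟨β, j⟩ : JordanVar (ones J)) = ⟨α, i⟩) ↔ (α = β ∧ i = j) := by
    constructor
    · rintro h
      cases h
      exact ⟨rfl, rfl⟩
    · rintro ⟨rfl, rfl⟩
      rfl
  simp only [this]

variable [Fintype J]

theorem weitzenboeck_ones_apply (P : MvPolynomial (JordanVar (ones J)) K) :
    weitzenboeck K (ones J) P = ∑ α : J, letter K α 0 * letterDeriv K α 1 P := by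
  have h : weitzenboeck K (ones J) = ∑ α : J, letter K α 0 • letterDeriv K α 1 := by
    refine derivation_ext ?_
    rintro ⟨β, i⟩
    rw [derivation_sum_apply]
    change weitzenboeck K (ones J) (letter K β i)
      = ∑ α : J, letter K α 0 * letterDeriv K α 1 (letter K β i)
    simp only [letterDeriv_letter]
    fin_cases i
    · simpa using weitzenboeck_letter_zero K β
    · simpa using weitzenboeck_letter_one K β
  rw [h, derivation_sum_apply]
  rfl

theorem weitzenboeck_letterDeriv_one (β : J) (P : MvPolynomial (JordanVar (ones J)) K) :
    weitzenboeck K (ones J) (letterDeriv K β 1 P) =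
      letterDeriv K β 1 (weitzenboeck K (ones J) P) := by
  simp only [weitzenboeck_ones_apply, map_sum, Derivation.leibniz, letterDeriv_letter]
  simp [letterDeriv_comm K β _ 1 1]

/-- As `D = ∑ α_0 ∂/∂α_1`, moving `∂/∂β_0` past `D` only picks up the derivative of the coefficient
`β_0`. -/
theorem weitzenboeck_letterDeriv_zero (β : J) (P : MvPolynomial (JordanVar (ones J)) K) :
    weitzenboeck K (ones J) (letterDeriv K β 0 P) =
      letterDeriv K β 0 (weitzenboeck K (ones J) P) - letterDeriv K β 1 P := by
  simp only [weitzenboeck_ones_apply, map_sum, Derivation.leibniz, letterDeriv_letter]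
  simp [letterDeriv_comm K β _ 0 1, Finset.sum_add_distrib]

/-- Each of the two terms of the process leaves the correction `-∂/∂α_1 ∂/∂β_1 P`, and these cancel.
-/
theorem weitzenboeck_cayley (α β : J) {P : MvPolynomial (JordanVar (ones J)) K}
    (hP : weitzenboeck K (ones J) P = 0) : weitzenboeck K (ones J) (cayley K α β P) = 0 := by
  simp only [cayley, map_sub, weitzenboeck_letterDeriv_one, weitzenboeck_letterDeriv_zero, hP,
    map_zero, zero_sub, map_neg]
  rw [letterDeriv_comm K α β 1 1]
  ring

/-- A form of the Gordan-Capelli identity on semi-invariants. -/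
theorem sum_bracket_mul_cayley {P : MvPolynomial (JordanVar (ones J)) K}
    (hP : weitzenboeck K (ones J) P = 0) {a b : K}
    (h0 : ∑ α : J, letter K α 0 * letterDeriv K α 0 P = a • P)
    (h1 : ∑ α : J, letter K α 1 * letterDeriv K α 1 P = b • P) :
    ∑ α : J, ∑ β : J, bracket K α β * cayley K α β P = (2 * b * (a + 1)) • P := by
  -- `∂/∂α_0` does not see `β_1`, so this is the product of the two Euler operators.
  have e1 : ∑ α : J, ∑ β : J,
      letter K α 0 * letter K β 1 * letterDeriv K α 0 (letterDeriv K β 1 P) = (a * b) • P := by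
    have : ∀ α : J, ∑ β : J,
        letter K α 0 * letter K β 1 * letterDeriv K α 0 (letterDeriv K β 1 P)
        = b • (letter K α 0 * letterDeriv K α 0 P) := fun α => by
      rw [← mul_smul_comm, ← Derivation.map_smul, ← h1, map_sum, Finset.mul_sum]
      refine Finset.sum_congr rfl fun β _ => ?_
      rw [Derivation.leibniz, letterDeriv_letter]
      simp [mul_assoc]
    rw [Finset.sum_congr rfl fun α _ => this α, ← Finset.smul_sum, h0, smul_smul, mul_comm]
  -- For fixed `β` the sum over `α` is `β_1 · D(∂P/∂β_0) = -β_1 ∂P/∂β_1`; this is where `D P = 0`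
  -- enters.
  have e2 : ∑ α : J, ∑ β : J,
      letter K α 0 * letter K β 1 * letterDeriv K α 1 (letterDeriv K β 0 P) = -(b • P) := by
    rw [Finset.sum_comm, ← h1, ← Finset.sum_neg_distrib]
    refine Finset.sum_congr rfl fun β _ => ?_
    have h := weitzenboeck_letterDeriv_zero K β P
    rw [hP, map_zero, zero_sub, weitzenboeck_ones_apply] at h
    rw [← mul_neg, ← h, Finset.mul_sum]
    exact Finset.sum_congr rfl fun α _ => by ring
  -- The other two terms of the expanded product are the first two with `α` and `β` exchanged; the
  -- total is `2(ab + b)`.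
  have e3 := Finset.sum_comm.trans e1
  have e4 := Finset.sum_comm.trans e2
  have : ∀ α β : J, bracket K α β * cayley K α β P =
      letter K α 0 * letter K β 1 * letterDeriv K α 0 (letterDeriv K β 1 P)
      - letter K α 0 * letter K β 1 * letterDeriv K α 1 (letterDeriv K β 0 P)
      - letter K β 0 * letter K α 1 * letterDeriv K β 1 (letterDeriv K α 0 P)
      + letter K β 0 * letter K α 1 * letterDeriv K β 0 (letterDeriv K α 1 P) := fun α β => by
    rw [bracket, cayley, letterDeriv_comm K β α 1 0, letterDeriv_comm K β α 0 1]
    ring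
  simp only [this, Finset.sum_add_distrib, Finset.sum_sub_distrib]
  rw [e1, e2, e3, e4]
  module

end FirstFundamentalTheorem

/-! ### The first fundamental theorem by induction on the degree -/

theorem prod_jordanVar_ones {J M : Type*} [Fintype J] [CommMonoid M] (f : JordanVar (ones J) → M) :
    ∏ p, f p = ∏ α : J, f ⟨α, 0⟩ * f ⟨α, 1⟩ :=
  (Fintype.prod_sigma _).trans (Finset.prod_congr rfl fun _ _ => Fin.prod_univ_two _)

theorem sum_jordanVar_ones {J M : Type*} [Fintype J] [AddCommMonoid M]
    (f : JordanVar (ones J) → M) : ∑ p, f p = ∑ α : J, (f ⟨α, 0⟩ + f ⟨α, 1⟩) :=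
  (Fintype.sum_sigma _).trans (Finset.sum_congr rfl fun _ _ => Fin.sum_univ_two _)

section FirstFundamentalTheorem

variable (K : Type*) [Field K] {J : Type*}

/-- The bidegree of a variable of `Sym (V_J)`: its degree in the `α_0` and its total degree. -/
def bidegree (p : JordanVar (ones J)) : ℕ × ℕ := (if p.2 = 0 then 1 else 0, 1)

theorem bracket_mem_range_chi (α β : J) : bracket K α β ∈ (chi K J).range := by
  by_cases h : α = β
  · subst h
    rw [bracket, mul_comm, sub_self]
    exact zero_mem _
  · exact ⟨X (.pair α β h), aeval_X _ _⟩

theorem letter_zero_mem_range_chi (α : J) : letter K α 0 ∈ (chi K J).range :=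
  ⟨X (.single α), aeval_X _ _⟩

theorem isWeightedHomogeneous_cayley (α β : J) {n : ℕ × ℕ}
    {P : MvPolynomial (JordanVar (ones J)) K} (hP : IsWeightedHomogeneous bidegree P n) :
    IsWeightedHomogeneous bidegree (cayley K α β P) (n - (1, 2)) := by
  have h1 := isWeightedHomogeneous_pderiv_sub
    (isWeightedHomogeneous_pderiv_sub hP ⟨β, 1⟩) ⟨α, 0⟩
  have h2 := isWeightedHomogeneous_pderiv_sub
    (isWeightedHomogeneous_pderiv_sub hP ⟨β, 0⟩) ⟨α, 1⟩
  rw [tsub_tsub] at h1 h2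
  exact IsWeightedHomogeneous.sub h1 h2

variable [Fintype J]

theorem sum_letter_zero_mul_letterDeriv {n : ℕ × ℕ} {P : MvPolynomial (JordanVar (ones J)) K}
    (hP : IsWeightedHomogeneous bidegree P n) :
    ∑ α : J, letter K α 0 * letterDeriv K α 0 P = (n.1 : K) • P := by
  have h := (isWeightedHomogeneous_map_weight (AddMonoidHom.fst ℕ ℕ) hP).sum_weight_X_mul_pderiv
  rw [sum_jordanVar_ones] at h
  simp only [bidegree, AddMonoidHom.coe_fst, Nat.cast_smul_eq_nsmul] at h ⊢
  rw [← h]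
  simp [letter, letterDeriv]

theorem sum_letter_one_mul_letterDeriv {n : ℕ × ℕ} {P : MvPolynomial (JordanVar (ones J)) K}
    (hP : IsWeightedHomogeneous bidegree P n) :
    ∑ α : J, letter K α 1 * letterDeriv K α 1 P = ((n.2 : K) - n.1) • P := by
  have h := (isWeightedHomogeneous_map_weight (AddMonoidHom.snd ℕ ℕ) hP).sum_weight_X_mul_pderiv
  rw [sum_jordanVar_ones] at h
  rw [sub_smul, ← sum_letter_zero_mul_letterDeriv K hP, eq_sub_iff_add_eq,
    ← Finset.sum_add_distrib]
  simp only [bidegree, AddMonoidHom.coe_snd, Nat.cast_smul_eq_nsmul] at h ⊢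
  rw [← h]
  simp [letter, letterDeriv, add_comm]

theorem weight_bidegree (s : JordanVar (ones J) →₀ ℕ) :
    Finsupp.weight bidegree s = (∑ α : J, s ⟨α, 0⟩, ∑ α : J, (s ⟨α, 0⟩ + s ⟨α, 1⟩)) := by
  rw [weight_eq_sum, sum_jordanVar_ones]
  simp only [bidegree]
  ext <;> simp [Prod.fst_sum, Prod.snd_sum]

variable [DecidableEq J]

theorem isWeightedHomogeneous_bidegree_weitzenboeck {n : ℕ × ℕ}
    {P : MvPolynomial (JordanVar (ones J)) K} (hP : IsWeightedHomogeneous bidegree P n) :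
    IsWeightedHomogeneous bidegree (weitzenboeck K (ones J) P) (n + (1, 0)) := by
  rw [weitzenboeck_ones_apply]
  exact IsWeightedHomogeneous.sum _ _ _ fun α _ =>
    isWeightedHomogeneous_X_mul_pderiv hP (by simp [bidegree])

/-- The first fundamental theorem for `𝔲₂` in one bidegree. -/
theorem mem_range_chi_of_bidegree [CharZero K] (n : ℕ × ℕ) (P : MvPolynomial (JordanVar (ones J)) K)
    (hP : IsWeightedHomogeneous bidegree P n) (hD : weitzenboeck K (ones J) P = 0) :
    P ∈ (chi K J).range := by
  induction hk : n.2 using Nat.strong_induction_on generalizing n P with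
  | _ k ih =>
  by_cases hP0 : P = 0
  · rw [hP0]
    exact zero_mem _
  obtain ⟨s, hs⟩ := ne_zero_iff.mp hP0
  have hn := hP hs
  rw [weight_bidegree] at hn
  have hle : n.1 ≤ n.2 := by
    rw [← hn]
    exact Finset.sum_le_sum fun α _ => Nat.le_add_right _ _
  -- Equality means that no `α_1` occurs, so `P` is a polynomial in the `α_0`.
  by_cases hne : n.1 = n.2
  · rw [P.as_sum]
    refine Subalgebra.sum_mem _ fun u hu => ?_
    have hun := hP (mem_support_iff.mp hu)
    rw [weight_bidegree] at hun
    rw [← hun] at hne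
    simp only [Finset.sum_add_distrib, left_eq_add, Finset.sum_eq_zero_iff, Finset.mem_univ,
      true_implies] at hne
    rw [monomial_eq, Finsupp.prod_fintype _ _ (fun _ => pow_zero _), prod_jordanVar_ones]
    refine mul_mem (Subalgebra.algebraMap_mem _ _) (prod_mem fun α _ => ?_)
    refine mul_mem (pow_mem (letter_zero_mem_range_chi K α) _) ?_
    rw [hne α, pow_zero]
    exact one_mem _
  · have hid := sum_bracket_mul_cayley K hD (sum_letter_zero_mul_letterDeriv K hP)
      (sum_letter_one_mul_letterDeriv K hP)
    have hc : 2 * ((n.2 : K) - n.1) * (n.1 + 1) ≠ 0 := by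
      refine mul_ne_zero (mul_ne_zero two_ne_zero (sub_ne_zero.mpr ?_)) (Nat.cast_add_one_ne_zero _)
      exact_mod_cast Ne.symm hne
    rw [← inv_smul_smul₀ hc P, ← hid]
    refine Subalgebra.smul_mem _ (sum_mem fun α _ => sum_mem fun β _ => ?_) _
    refine mul_mem (bracket_mem_range_chi K α β) ?_
    refine ih (n - (1, 2)).2 ?_ _ _ (isWeightedHomogeneous_cayley K α β hP)
      (weitzenboeck_cayley K α β hD) rfl
    -- The truncated difference still drops, since `n.1 ≤ n.2` and `n.1 ≠ n.2` force `n.2 > 0`.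
    change n.2 - 2 < k
    omega

/-- The first fundamental theorem for `𝔲₂`: the kernel of the derivation `α_1 ↦ α_0 ↦ 0` is
generated by the brackets and the letters `α_0`. -/
theorem mem_range_chi [CharZero K] {P : MvPolynomial (JordanVar (ones J)) K}
    (hD : weitzenboeck K (ones J) P = 0) : P ∈ (chi K J).range := by
  refine mem_of_weightedHomogeneousComponent_mem bidegree
    (A := Subalgebra.toSubmodule (chi K J).range) fun n => ?_
  refine mem_range_chi_of_bidegree K n _ (weightedHomogeneousComponent_isWeightedHomogeneous _ _) ?_
  -- `D` shifts the bidegree by `(1, 0)`, so it kills each bihomogeneous component of `P`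
  -- separately.
  have h := weightedHomogeneousComponent_map (add_left_injective ((1, 0) : ℕ × ℕ))
    (weitzenboeck K (ones J)).toLinearMap
    (fun _ _ => isWeightedHomogeneous_bidegree_weitzenboeck K) n P
  refine h.symm.trans ?_
  change weightedHomogeneousComponent _ _ (weitzenboeck K (ones J) P) = 0
  rw [hD, map_zero]

/-- `χ` preserves weights, so any preimage may be replaced by its component of weight `w`. -/
theorem chiOn_surjective [CharZero K] (w : J → ℕ) : Function.Surjective (chiOn K w) := by
  rintro ⟨P, hP, hD⟩
  obtain ⟨Q, rfl⟩ := mem_range_chi K hD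
  refine ⟨⟨weightedHomogeneousComponent BracketVar.weight w Q,
    weightedHomogeneousComponent_isWeightedHomogeneous _ _⟩, Subtype.ext ?_⟩
  have h := weightedHomogeneousComponent_map Function.injective_id (chi K J).toLinearMap
    (fun v P hP => (chi_mem K v P hP).1) w Q
  exact h.symm.trans (IsWeightedHomogeneous.weightedHomogeneousComponent_same hP)

end FirstFundamentalTheorem

/-! ### Permutations within classes -/

section Combinatorics

/-- Two families with the same values, counted with multiplicity, differ by a permutation. -/
theorem exists_perm_of_sum_single_eq {J T : Type*} [Fintype J] {f g : J → T}
    (h : ∑ α, Finsupp.single (f α) 1 = ∑ α, (Finsupp.single (g α) 1 : T →₀ ℕ)) :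
    ∃ σ : Equiv.Perm J, ∀ α, g (σ α) = f α := by
  classical
  -- Corresponding fibres have equal size; the permutation is glued from bijections between them.
  have hc : ∀ t, Nonempty ({α // f α = t} ≃ {α // g α = t}) := fun t => by
    refine ⟨Fintype.equivOfCardEq ?_⟩
    have := DFunLike.congr_fun h t
    simpa [Finsupp.finsetSum_apply, Finsupp.single_apply, Finset.sum_boole,
      Fintype.card_subtype] using this
  let E : ∀ t, {α // f α = t} ≃ {α // g α = t} := fun t => (hc t).some
  refine ⟨(Equiv.sigmaFiberEquiv f).symm.trans
    ((Equiv.sigmaCongrRight E).trans (Equiv.sigmaFiberEquiv g)), fun α => ?_⟩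
  exact (E (f α) ⟨α, rfl⟩).2

/-- The permutations of the letters that preserve the classes. -/
def classPerm {J I : Type*} (cls : J → I) : Subgroup (Equiv.Perm J) where
  carrier := {σ | ∀ α, cls (σ α) = cls α}
  mul_mem' {σ τ} hσ hτ α := (hσ (τ α)).trans (hτ α)
  one_mem' _ := rfl
  inv_mem' {σ} hσ α := by simpa using (hσ (σ⁻¹ α)).symm

/-- Class-preserving permutations are built from permutations that move only one class. -/
theorem classPerm_induction {J I : Type*} [Fintype J] [DecidableEq J] {cls : J → I}
    {p : Equiv.Perm J → Prop} (one : p 1)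
    (mul : ∀ (x : I) (τ σ : Equiv.Perm J), (∀ α, cls α ≠ x → τ α = α) →
      τ ∈ classPerm cls → σ ∈ classPerm cls → p σ → p (τ * σ))
    {σ : Equiv.Perm J} (hσ : σ ∈ classPerm cls) : p σ := by
  induction hn : σ.support.card using Nat.strong_induction_on generalizing σ with
  | _ n ih =>
  by_cases h : σ = 1
  · rwa [h]
  obtain ⟨α, hα⟩ : ∃ α, σ α ≠ α := by
    by_contra! hc
    exact h (Equiv.ext hc)
  -- The transposition of `α` and `σ α` stays in one class, and multiplying by it shrinks the
  -- support of `σ`.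
  have hτ : ∀ β, Equiv.swap α (σ α) β ≠ β → cls β = cls α ∧
      cls (Equiv.swap α (σ α) β) = cls α := fun β hβ => by
    rcases (Equiv.swap_apply_ne_self_iff.mp hβ).2 with rfl | rfl
    · simp [hσ β]
    · simp [hσ α]
  have hmem : Equiv.swap α (σ α) ∈ classPerm cls := fun β => by
    by_cases hβ : Equiv.swap α (σ α) β = β
    · rw [hβ]
    · rw [(hτ β hβ).1, (hτ β hβ).2]
  have hmem' := mul_mem hmem hσ
  have := mul (cls α) _ _ (fun β hβ => by_contra fun hc => hβ (hτ β hc).1) hmem hmem'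
    (ih _ (hn ▸ Equiv.Perm.card_support_swap_mul hα) hmem' rfl)
  rwa [Equiv.swap_mul_self_mul] at this

end Combinatorics

/-! ### Permutation actions and their compatibility with `χ`, `D` and weights -/

section Permutations

variable (K : Type*) [Field K] {J : Type*}

/-- The action of a permutation of the letters on the variables of `Sym (V_J)`. -/
def permVar (σ : Equiv.Perm J) (p : JordanVar (ones J)) : JordanVar (ones J) := ⟨σ p.1, p.2⟩

theorem permVar_injective (σ : Equiv.Perm J) : Function.Injective (permVar σ) :=
  fun p q h => by
  obtain ⟨α, i⟩ := p
  obtain ⟨β, j⟩ := q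
  obtain ⟨h1, h2⟩ := Sigma.mk.inj_iff.mp h
  obtain rfl := σ.injective h1
  obtain rfl := eq_of_heq h2
  rfl

theorem rename_permVar_letter (σ : Equiv.Perm J) (α : J) (i : Fin 2) :
    rename (permVar σ) (letter K α i) = letter K (σ α) i := rename_X _ _

theorem rename_permVar_mul (σ τ : Equiv.Perm J) (P : MvPolynomial (JordanVar (ones J)) K) :
    rename (permVar (σ * τ)) P = rename (permVar σ) (rename (permVar τ) P) :=
  (rename_rename (permVar τ) (permVar σ) P).symm

theorem chi_rename (σ : Equiv.Perm J) (P : MvPolynomial (BracketVar J) K) :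
    chi K J (rename (BracketVar.perm σ) P) = rename (permVar σ) (chi K J P) := by
  have : (chi K J).comp (rename (BracketVar.perm σ)) = (rename (permVar σ)).comp (chi K J) := by
    refine algHom_ext fun v => ?_
    have hX : ∀ v, chi K J (X v) = chiVar K v := aeval_X _
    rw [AlgHom.comp_apply, AlgHom.comp_apply, rename_X, hX, hX]
    cases v <;> simp [chiVar, BracketVar.perm, bracket, rename_permVar_letter]
  exact DFunLike.congr_fun this P

theorem weitzenboeck_rename (σ : Equiv.Perm J) (P : MvPolynomial (JordanVar (ones J)) K) :
    weitzenboeck K (ones J) (rename (permVar σ) P) =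
      rename (permVar σ) (weitzenboeck K (ones J) P) := by
  induction P using MvPolynomial.induction_on with
  | C a => simp
  | add p q hp hq => simp only [map_add, hp, hq]
  | mul_X p v hp =>
    obtain ⟨α, i⟩ := v
    change weitzenboeck K (ones J) (rename (permVar σ) (p * letter K α i)) =
      rename (permVar σ) (weitzenboeck K (ones J) (p * letter K α i))
    have hl : weitzenboeck K (ones J) (letter K (σ α) i) =
        rename (permVar σ) (weitzenboeck K (ones J) (letter K α i)) := by
      fin_cases i
      · exact (weitzenboeck_letter_zero K _).trans
          (by rw [show weitzenboeck K (ones J) (letter K α ((fun i => i) ⟨0, by decide⟩)) = 0 from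
            weitzenboeck_letter_zero K α, map_zero])
      · exact (weitzenboeck_letter_one K _).trans
          (by rw [show weitzenboeck K (ones J) (letter K α ((fun i => i) ⟨1, by decide⟩)) = _ from
            weitzenboeck_letter_one K α, rename_permVar_letter])
    simp only [map_mul, Derivation.leibniz, hp, smul_eq_mul, map_add, rename_permVar_letter, hl]

variable [DecidableEq J]

theorem rename_perm_mem_bracketComponent {w : J → ℕ} {σ : Equiv.Perm J} (hσ : ∀ α, w (σ α) = w α)
    {P : MvPolynomial (BracketVar J) K} (hP : P ∈ bracketComponent K w) :
    rename (BracketVar.perm σ) P ∈ bracketComponent K w := by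
  have h := isWeightedHomogeneous_rename (w' := BracketVar.weight)
    (LinearMap.funLeft ℕ ℕ σ.symm).toAddMonoidHom (BracketVar.perm σ) (fun v => ?_) hP
  · rwa [show (LinearMap.funLeft ℕ ℕ σ.symm).toAddMonoidHom w = w from
      funext fun α => by simpa [LinearMap.funLeft_apply] using (hσ (σ.symm α)).symm] at h
  · ext α
    cases v <;> simp [BracketVar.perm, BracketVar.weight, LinearMap.funLeft_apply, Pi.single_apply,
      Equiv.symm_apply_eq]

theorem rename_permVar_mem_multidegree {w : J → ℕ} {σ : Equiv.Perm J} (hσ : ∀ α, w (σ α) = w α)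
    {P : MvPolynomial (JordanVar (ones J)) K} (hP : P ∈ multidegree K (ones J) w) :
    rename (permVar σ) P ∈ multidegree K (ones J) w := by
  have h := isWeightedHomogeneous_rename
    (w' := fun p : JordanVar (ones J) => (Pi.single p.1 1 : J → ℕ))
    (LinearMap.funLeft ℕ ℕ σ.symm).toAddMonoidHom (permVar σ) (fun v => ?_) hP
  · rwa [show (LinearMap.funLeft ℕ ℕ σ.symm).toAddMonoidHom w = w from
      funext fun α => by simpa [LinearMap.funLeft_apply] using (hσ (σ.symm α)).symm] at h
  · ext α
    simp [permVar, LinearMap.funLeft_apply, Pi.single_apply, Equiv.symm_apply_eq]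

end Permutations

/-! ### The symbolic map on monomials -/

section SymbolicMap

variable (K : Type*) [Field K] {J I : Type*} [Fintype J] (cls : J → I) (d : I → ℕ)

/-- The variable `x_i`, with `i` truncated at `d x`. -/
def jordanVar (x : I) (i : ℕ) : JordanVar d := ⟨x, ⟨min i (d x), by omega⟩⟩

theorem jordanVar_of_le {x : I} {i : ℕ} (h : i ≤ d x) :
    jordanVar d x i = ⟨x, ⟨i, Nat.lt_succ_of_le h⟩⟩ := by
  simp [jordanVar, h]

/-- The exponent of the monomial `∏ α, φ(α)_{e α}`. -/
noncomputable def imageExp (e : J → ℕ) : JordanVar d →₀ ℕ :=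
  ∑ α, Finsupp.single (jordanVar d (cls α) (e α)) 1

/-- The map sending `∏ α, α_0 ^ j_α * α_1 ^ i_α` to `∏ α, i_α! φ(α)_{i_α}`. -/
noncomputable def symbolicMap :
    MvPolynomial (JordanVar (ones J)) K →ₗ[K] MvPolynomial (JordanVar d) K :=
  -- The exponents of the `α_0` are forgotten; once the weight is fixed, those of the `α_1`
  -- determine them.
  (basisMonomials (JordanVar (ones J)) K).constr K fun s =>
    monomial (imageExp cls d fun α => s ⟨α, 1⟩) (∏ α, ((s ⟨α, 1⟩).factorial : K))

theorem symbolicMap_monomial (s : JordanVar (ones J) →₀ ℕ) :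
    symbolicMap K cls d (monomial s 1) =
      monomial (imageExp cls d fun α => s ⟨α, 1⟩) (∏ α, ((s ⟨α, 1⟩).factorial : K)) := by
  have := (basisMonomials (JordanVar (ones J)) K).constr_basis K (fun s =>
    monomial (imageExp cls d fun α => s ⟨α, 1⟩) (∏ α, ((s ⟨α, 1⟩).factorial : K))) s
  rwa [coe_basisMonomials] at this

theorem symbolicMap_monomial' (s : JordanVar (ones J) →₀ ℕ) (a : K) :
    symbolicMap K cls d (monomial s a) =
      monomial (imageExp cls d fun α => s ⟨α, 1⟩) (a * ∏ α, ((s ⟨α, 1⟩).factorial : K)) := by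
  rw [← mul_one a, ← smul_eq_mul, ← smul_monomial, map_smul, symbolicMap_monomial, smul_monomial]
  simp

/-- The exponent of `letterMonomial`. -/
noncomputable def letterExp (w e : J → ℕ) : JordanVar (ones J) →₀ ℕ :=
  Finsupp.equivFunOnFinite.symm fun p => if p.2 = 0 then w p.1 - e p.1 else e p.1

theorem letterMonomial_eq (w e : J → ℕ) :
    letterMonomial K w e = monomial (letterExp w e) 1 := by
  rw [monomial_eq, Finsupp.prod_fintype _ _ (fun _ => pow_zero _), prod_jordanVar_ones, C_1,
    one_mul]
  rfl

theorem symbolicMap_letterMonomial (w e : J → ℕ) :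
    symbolicMap K cls d (letterMonomial K w e) =
      monomial (imageExp cls d e) (∏ α, ((e α).factorial : K)) := by
  rw [letterMonomial_eq, symbolicMap_monomial]
  rfl

theorem monomial_imageExp_eq_prod (e : J → ℕ) :
    monomial (imageExp cls d e) (∏ α, ((e α).factorial : K)) =
      ∏ α, C ((e α).factorial : K) * X (jordanVar d (cls α) (e α)) := by
  rw [imageExp, Finset.prod_mul_distrib, ← mul_one (∏ α, ((e α).factorial : K)), ← C_mul_monomial,
    monomial_sum_one, map_prod]
  rfl

theorem monomial_imageExp (e : J → ℕ) (he : ∀ α, e α ≤ d (cls α)) :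
    monomial (imageExp cls d e) (∏ α, ((e α).factorial : K)) =
      ∏ α, C (((e α).factorial : ℕ) : K) * X ⟨cls α, ⟨e α, Nat.lt_succ_of_le (he α)⟩⟩ := by
  simp only [monomial_imageExp_eq_prod, jordanVar_of_le d (he _)]

theorem symbolicMap_rename {σ : Equiv.Perm J} (hσ : σ ∈ classPerm cls)
    (P : MvPolynomial (JordanVar (ones J)) K) :
    symbolicMap K cls d (rename (permVar σ) P) = symbolicMap K cls d P := by
  induction P using MvPolynomial.induction_on' with
  | add p q hp hq => simp only [map_add, hp, hq]
  | monomial s a =>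
    have hs : ∀ α, s.mapDomain (permVar σ) ⟨σ α, 1⟩ = s ⟨α, 1⟩ := fun α =>
      Finsupp.mapDomain_apply (permVar_injective σ) s ⟨α, 1⟩
    rw [rename_monomial, symbolicMap_monomial', symbolicMap_monomial']
    congr 1
    · rw [imageExp, imageExp, ← Equiv.sum_comp σ]
      simp only [hs, hσ _]
    · rw [← Equiv.prod_comp σ]
      simp only [hs]

end SymbolicMap

/-! ### A common lowering rule for the two derivations -/

theorem derivation_prod {R A ι : Type*} [CommSemiring R] [CommSemiring A] [Algebra R A]
    [DecidableEq ι] (D : Derivation R A A) (s : Finset ι) (f : ι → A) :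
    D (∏ i ∈ s, f i) = ∑ i ∈ s, D (f i) * ∏ j ∈ s.erase i, f j := by
  induction s using Finset.induction_on with
  | empty => simp
  | insert a s ha ih =>
    rw [Finset.prod_insert ha, Derivation.leibniz, ih, Finset.sum_insert ha,
      Finset.erase_insert ha, smul_eq_mul, smul_eq_mul, add_comm, Finset.mul_sum,
      mul_comm (D (f a))]
    congr 1
    refine Finset.sum_congr rfl fun i hi => ?_
    have hne : a ≠ i := fun h => ha (h ▸ hi)
    rw [Finset.erase_insert_of_ne hne,
      Finset.prod_insert fun h => ha (Finset.mem_of_mem_erase h)]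
    ring

/-- A derivation acting on `f α n` by `n ↦ n - 1` for each `α`, applied to a product. -/
theorem derivation_prod_lowering {R A J : Type*} [CommSemiring R] [CommSemiring A] [Algebra R A]
    [DecidableEq J] [Fintype J] (D : Derivation R A A) (f : J → ℕ → A) (e : J → ℕ)
    (hf : ∀ α, D (f α (e α)) = e α • f α (e α - 1)) :
    D (∏ α, f α (e α)) = ∑ α, e α • ∏ β, f β (Function.update e α (e α - 1) β) := by
  rw [derivation_prod]
  refine Finset.sum_congr rfl fun α _ => ?_
  rw [← Finset.mul_prod_erase _ _ (Finset.mem_univ α), hf, smul_mul_assoc, Function.update_self]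
  congr 2
  refine Finset.prod_congr rfl fun β hβ => ?_
  rw [Function.update_of_ne (Finset.ne_of_mem_erase hβ)]

section Monomials

variable (K : Type*) [Field K] {J I : Type*}

theorem weitzenboeck_letter_pow_mul (α : J) {n w : ℕ} (h : n ≤ w) :
    weitzenboeck K (ones J) (letter K α 0 ^ (w - n) * letter K α 1 ^ n) =
      n • (letter K α 0 ^ (w - (n - 1)) * letter K α 1 ^ (n - 1)) := by
  rw [Derivation.leibniz, Derivation.leibniz_pow, Derivation.leibniz_pow,
    weitzenboeck_letter_zero, weitzenboeck_letter_one]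
  cases n with
  | zero => simp
  | succ k =>
    -- Needs `k + 1 ≤ w`, since the subtraction is truncated.
    rw [show w - (k + 1 - 1) = w - (k + 1) + 1 by omega, Nat.add_sub_cancel]
    simp only [smul_eq_mul, nsmul_eq_mul, mul_zero, add_zero]
    ring

/-- The factorial turns `x_n ↦ x_{n-1}` into the rule obeyed by `α_0^(w-n) α_1^n`. For `n = 0` the
coefficient vanishes, so the truncated index does not matter. -/
theorem weitzenboeck_jordanVar (d : I → ℕ) (x : I) {n : ℕ} (h : n ≤ d x) :
    weitzenboeck K d (C (n.factorial : K) * X (jordanVar d x n)) =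
      n • (C ((n - 1).factorial : K) * X (jordanVar d x (n - 1))) := by
  rw [← smul_eq_C_mul, Derivation.map_smul, weitzenboeck, mkDerivation_X]
  cases n with
  | zero =>
    rw [if_pos (Fin.ext (Nat.zero_min _))]
    simp
  | succ k =>
    rw [jordanVar_of_le d h, jordanVar_of_le d (by omega : k + 1 - 1 ≤ d x), if_neg]
    · simp only [Nat.add_sub_cancel, Nat.factorial_succ, Nat.cast_mul, nsmul_eq_mul, smul_eq_C_mul,
        C_mul, map_natCast, mul_assoc]
    · simp [Fin.ext_iff]

theorem weight_single_apply [Fintype J] [DecidableEq J] (s : JordanVar (ones J) →₀ ℕ) (α : J) :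
    Finsupp.weight (fun p : JordanVar (ones J) => (Pi.single p.1 1 : J → ℕ)) s α =
      s ⟨α, 0⟩ + s ⟨α, 1⟩ := by
  rw [weight_eq_sum, sum_jordanVar_ones,
    Finset.sum_apply]
  simp [Pi.single_apply, Finset.sum_add_distrib]

theorem eq_letterExp [Fintype J] [DecidableEq J] {w : J → ℕ} {s : JordanVar (ones J) →₀ ℕ}
    (hs : Finsupp.weight (fun p : JordanVar (ones J) => (Pi.single p.1 1 : J → ℕ)) s = w) :
    (∀ α, s ⟨α, 1⟩ ≤ w α) ∧ s = letterExp w fun α => s ⟨α, 1⟩ := by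
  have h : ∀ α, s ⟨α, 0⟩ + s ⟨α, 1⟩ = w α := fun α => by rw [← weight_single_apply, hs]
  refine ⟨fun α => h α ▸ Nat.le_add_left _ _, Finsupp.ext ?_⟩
  rintro ⟨α, i⟩
  fin_cases i
  · change s ⟨α, 0⟩ = w α - s ⟨α, 1⟩
    rw [← h α, Nat.add_sub_cancel]
  · rfl

theorem multidegree_ones_le_span [Fintype J] [DecidableEq J] (w : J → ℕ) :
    multidegree K (ones J) w ≤
      Submodule.span K {P | ∃ e : J → ℕ, (∀ α, e α ≤ w α) ∧ P = letterMonomial K w e} := by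
  intro P hP
  rw [P.as_sum]
  refine Submodule.sum_mem _ fun s hs => ?_
  obtain ⟨hle, hs'⟩ := eq_letterExp (hP (mem_support_iff.mp hs))
  rw [← mul_one (coeff s P), ← smul_eq_mul, ← smul_monomial]
  refine Submodule.smul_mem _ _ (Submodule.subset_span ⟨_, hle, ?_⟩)
  rw [letterMonomial_eq, ← hs']

end Monomials

/-! ### Equivariance, surjectivity and fibres of the symbolic map -/

section SymbolicMap

variable (K : Type*) [Field K] {J I : Type*} [Fintype J] [DecidableEq I] (cls : J → I) (d : I → ℕ)

theorem weight_imageExp (e : J → ℕ) :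
    Finsupp.weight (fun p : JordanVar d => (Pi.single p.1 1 : I → ℕ)) (imageExp cls d e) =
      classSize cls := by
  ext x
  simp [imageExp, map_sum, Finsupp.weight_single, jordanVar, classSize, Fintype.card_subtype,
    Finset.sum_apply, Pi.single_apply, Finset.sum_boole, eq_comm]

theorem symbolicMap_mem (P : MvPolynomial (JordanVar (ones J)) K) :
    symbolicMap K cls d P ∈ multidegree K d (classSize cls) := by
  induction P using MvPolynomial.induction_on' with
  | add p q hp hq => rw [map_add]; exact Submodule.add_mem _ hp hq
  | monomial s a =>
    rw [symbolicMap_monomial']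
    exact isWeightedHomogeneous_monomial _ _ _ (weight_imageExp cls d _)

variable [DecidableEq J]

-- It suffices to compare on the spanning letter monomials, where both sides lower one exponent `e
-- α` at a time with coefficient `e α`.
omit [DecidableEq I] in
theorem symbolicMap_weitzenboeck {P : MvPolynomial (JordanVar (ones J)) K}
    (hP : P ∈ multidegree K (ones J) (d ∘ cls)) :
    symbolicMap K cls d (weitzenboeck K (ones J) P) =
      weitzenboeck K d (symbolicMap K cls d P) := by
  have h : Set.EqOn (symbolicMap K cls d ∘ₗ (weitzenboeck K (ones J)).toLinearMap)
      ((weitzenboeck K d).toLinearMap ∘ₗ symbolicMap K cls d)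
      {P | ∃ e : J → ℕ, (∀ α, e α ≤ (d ∘ cls) α) ∧ P = letterMonomial K (d ∘ cls) e} := by
    rintro _ ⟨e, he, rfl⟩
    change symbolicMap K cls d (weitzenboeck K (ones J) (letterMonomial K (d ∘ cls) e)) =
      weitzenboeck K d (symbolicMap K cls d (letterMonomial K (d ∘ cls) e))
    rw [symbolicMap_letterMonomial, monomial_imageExp_eq_prod,
      derivation_prod_lowering (weitzenboeck K d)
        (fun α n => C (n.factorial : K) * X (jordanVar d (cls α) n)) e
        fun α => weitzenboeck_jordanVar K d _ (he α),
      letterMonomial, derivation_prod_lowering (weitzenboeck K (ones J))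
        (fun α n => letter K α 0 ^ ((d ∘ cls) α - n) * letter K α 1 ^ n) e
        fun α => weitzenboeck_letter_pow_mul K α (he α), map_sum]
    refine Finset.sum_congr rfl fun α _ => ?_
    rw [map_nsmul, ← monomial_imageExp_eq_prod, ← symbolicMap_letterMonomial K cls d (d ∘ cls)]
    rfl
  exact LinearMap.eqOn_span h (multidegree_ones_le_span K _ hP)

omit [DecidableEq J] in
theorem exists_imageExp_eq [Fintype I] {Y : JordanVar d →₀ ℕ}
    (hY : Finsupp.weight (fun p : JordanVar d => (Pi.single p.1 1 : I → ℕ)) Y = classSize cls) :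
    ∃ e : J → ℕ, (∀ α, e α ≤ d (cls α)) ∧ imageExp cls d e = Y := by
  -- The right side lists the variables `x_i` of the monomial with multiplicity; there are `m_x` of
  -- them, one for each letter of the class.
  have hc : ∀ x, Nonempty ({α // cls α = x} ≃ (i : Fin (d x + 1)) × Fin (Y ⟨x, i⟩)) := fun x => by
    refine ⟨Fintype.equivOfCardEq ?_⟩
    have h := congrFun hY x
    rw [weight_eq_sum, Fintype.sum_sigma, Finset.sum_apply] at h
    rw [Fintype.card_sigma]
    simpa [Pi.single_apply, classSize, Finset.sum_apply, Finset.sum_ite_eq] using h.symm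
  let E := fun x => (hc x).some
  refine ⟨fun α => (E (cls α) ⟨α, rfl⟩).1.val,
    fun α => Nat.lt_succ_iff.mp (E (cls α) ⟨α, rfl⟩).1.isLt, ?_⟩
  have h1 : ∀ α, jordanVar d (cls α) (E (cls α) ⟨α, rfl⟩).1.val =
      ⟨cls α, (E (cls α) ⟨α, rfl⟩).1⟩ := fun α =>
    jordanVar_of_le d (Nat.lt_succ_iff.mp (E (cls α) ⟨α, rfl⟩).1.isLt)
  have h2 : ∀ x, ∑ a : {α // cls α = x}, (Finsupp.single
      (⟨cls a.1, (E (cls a.1) ⟨a.1, rfl⟩).1⟩ : JordanVar d) 1 : JordanVar d →₀ ℕ) =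
      ∑ i, Finsupp.single ⟨x, i⟩ (Y ⟨x, i⟩) := fun x => by
    let G : (i : Fin (d x + 1)) × Fin (Y ⟨x, i⟩) → JordanVar d →₀ ℕ :=
      fun q => Finsupp.single ⟨x, q.1⟩ 1
    have h3 : ∀ a : {α // cls α = x}, (Finsupp.single
      (⟨cls a.1, (E (cls a.1) ⟨a.1, rfl⟩).1⟩ : JordanVar d) 1 : JordanVar d →₀ ℕ) =
      G (E x a) := by
      rintro ⟨α, rfl⟩
      rfl
    refine (Fintype.sum_equiv (E x) _ G h3).trans ((Fintype.sum_sigma _).trans ?_)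
    simp [G]
  simp only [imageExp, h1]
  rw [← (Equiv.sigmaFiberEquiv cls).sum_comp, Fintype.sum_sigma]
  refine (Finset.sum_congr rfl fun x _ => h2 x).trans ?_
  rw [← Fintype.sum_sigma fun p : JordanVar d => Finsupp.single p (Y p)]
  exact Finsupp.univ_sum_single Y

theorem exists_symbolicMap_eq [CharZero K] [Fintype I]
    {Q : MvPolynomial (JordanVar d) K}
    (hQ : Q ∈ multidegree K d (classSize cls)) :
    ∃ P ∈ multidegree K (ones J) (d ∘ cls), symbolicMap K cls d P = Q := by
  change Q ∈ (multidegree K (ones J) (d ∘ cls)).map (symbolicMap K cls d)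
  rw [Q.as_sum]
  refine Submodule.sum_mem _ fun s hs => ?_
  obtain ⟨e, he, hes⟩ := exists_imageExp_eq cls d (hQ (mem_support_iff.mp hs))
  have hne : (∏ α, ((e α).factorial : K)) ≠ 0 :=
    Finset.prod_ne_zero_iff.mpr fun α _ => Nat.cast_ne_zero.mpr (Nat.factorial_ne_zero _)
  refine ⟨(coeff s Q / ∏ α, ((e α).factorial : K)) • letterMonomial K (d ∘ cls) e,
    Submodule.smul_mem _ _ (letterMonomial_mem K _ _ he), ?_⟩
  rw [map_smul, symbolicMap_letterMonomial, smul_monomial, smul_eq_mul, div_mul_cancel₀ _ hne, hes]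

omit [DecidableEq I] in
/-- Two monomials with the same image differ by a class-preserving permutation. -/
theorem exists_classPerm_of_imageExp_eq {s t : JordanVar (ones J) →₀ ℕ}
    (hs : Finsupp.weight (fun p : JordanVar (ones J) => (Pi.single p.1 1 : J → ℕ)) s = d ∘ cls)
    (ht : Finsupp.weight (fun p : JordanVar (ones J) => (Pi.single p.1 1 : J → ℕ)) t = d ∘ cls)
    (h : imageExp cls d (fun α => s ⟨α, 1⟩) = imageExp cls d fun α => t ⟨α, 1⟩) :
    ∃ σ ∈ classPerm cls, s.mapDomain (permVar σ) = t := by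
  obtain ⟨hs1, hs2⟩ := eq_letterExp hs
  obtain ⟨ht1, ht2⟩ := eq_letterExp ht
  obtain ⟨σ, hσ⟩ := exists_perm_of_sum_single_eq h
  have hcls : ∀ α, cls (σ α) = cls α := fun α => congrArg Sigma.fst (hσ α)
  have hval : ∀ α, t ⟨σ α, 1⟩ = s ⟨α, 1⟩ := fun α => by
    have := congrArg (fun p : JordanVar d => p.2.val) (hσ α)
    have h1 := hs1 α
    have h2 := ht1 (σ α)
    simp only [Function.comp_apply] at h1 h2
    simpa only [jordanVar, min_eq_left h1, min_eq_left h2] using this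
  refine ⟨σ, hcls, Finsupp.ext ?_⟩
  rintro ⟨β, i⟩
  obtain ⟨α, rfl⟩ := σ.surjective β
  refine (Finsupp.mapDomain_apply (permVar_injective σ) s ⟨α, i⟩).trans ?_
  fin_cases i
  · have h1 := weight_single_apply s α
    have h2 := weight_single_apply t (σ α)
    rw [hs] at h1
    rw [ht, hval α] at h2
    simp only [Function.comp_apply, hcls α] at h1 h2
    change s ⟨α, 0⟩ = t ⟨σ α, 0⟩
    omega
  · exact (hval α).symm

omit [DecidableEq I] in
/-- The symbolic map is injective on polynomials invariant under class-preserving permutations. -/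
theorem eq_zero_of_symbolicMap_eq_zero [CharZero K] {P : MvPolynomial (JordanVar (ones J)) K}
    (hP : P ∈ multidegree K (ones J) (d ∘ cls))
    (hinv : ∀ σ ∈ classPerm cls, rename (permVar σ) P = P) (h0 : symbolicMap K cls d P = 0) :
    P = 0 := by
  classical
  by_contra hne
  obtain ⟨t, ht⟩ := ne_zero_iff.mp hne
  set c := coeff t P * ∏ α, ((t ⟨α, 1⟩).factorial : K) with hc
  -- By invariance all monomials of `P` above one image contribute the same amount `c`, so they
  -- cannot cancel in characteristic 0.
  have hterm : ∀ s ∈ P.support,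
      imageExp cls d (fun α => s ⟨α, 1⟩) = imageExp cls d (fun α => t ⟨α, 1⟩) →
      coeff s P * ∏ α, ((s ⟨α, 1⟩).factorial : K) = c := fun s hs hst => by
    obtain ⟨σ, hσ, rfl⟩ := exists_classPerm_of_imageExp_eq cls d
      (hP (mem_support_iff.mp hs)) (hP ht) hst
    rw [hc, ← Equiv.prod_comp σ fun α => ((s.mapDomain (permVar σ) ⟨α, 1⟩).factorial : K)]
    congr 1
    · conv_rhs => rw [← hinv σ hσ]
      rw [coeff_rename_mapDomain _ (permVar_injective σ)]
    · exact Finset.prod_congr rfl fun α _ => by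
        rw [show s.mapDomain (permVar σ) ⟨σ α, 1⟩ = s ⟨α, 1⟩ from
          Finsupp.mapDomain_apply (permVar_injective σ) s ⟨α, 1⟩]
  have hcoeff := congrArg (coeff (imageExp cls d fun α => t ⟨α, 1⟩)) h0
  rw [P.as_sum, map_sum, coeff_sum, coeff_zero] at hcoeff
  simp only [symbolicMap_monomial', coeff_monomial] at hcoeff
  rw [← Finset.sum_filter, Finset.sum_congr rfl fun s hs => hterm s (Finset.mem_filter.mp hs).1
    (Finset.mem_filter.mp hs).2, Finset.sum_const, nsmul_eq_mul] at hcoeff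
  refine mul_ne_zero (Nat.cast_ne_zero.mpr (Finset.card_ne_zero_of_mem
    (a := t) (Finset.mem_filter.mpr ⟨mem_support_iff.mpr ht, by rfl⟩))) (mul_ne_zero ht ?_) hcoeff
  exact Finset.prod_ne_zero_iff.mpr fun α _ => Nat.cast_ne_zero.mpr (Nat.factorial_ne_zero _)

end SymbolicMap

/-! ### Lifting semi-invariants by averaging -/

section Averaging

variable (K : Type*) [Field K] [CharZero K] {J I : Type*} [Fintype J] [DecidableEq J]
  [DecidableEq I] (cls : J → I) (d : I → ℕ)

omit [CharZero K] [DecidableEq I] [Fintype J] [DecidableEq J] in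
/-- A sum over all class-preserving permutations is invariant. -/
theorem rename_sum_classPerm [Fintype (classPerm cls)] {σ : Equiv.Perm J} (hσ : σ ∈ classPerm cls)
    (P : MvPolynomial (JordanVar (ones J)) K) :
    rename (permVar σ) (∑ τ : classPerm cls, rename (permVar τ.1) P) =
      ∑ τ : classPerm cls, rename (permVar τ.1) P := by
  rw [map_sum]
  exact Fintype.sum_equiv (Equiv.mulLeft (⟨σ, hσ⟩ : classPerm cls)) _ _ fun τ =>
    (rename_permVar_mul K σ τ.1 P).symm

omit [CharZero K] [DecidableEq I] [Fintype J] in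
theorem sum_classPerm_mem [Fintype (classPerm cls)] {P : MvPolynomial (JordanVar (ones J)) K}
    (hP : P ∈ multidegree K (ones J) (d ∘ cls)) :
    ∑ τ : classPerm cls, rename (permVar τ.1) P ∈ multidegree K (ones J) (d ∘ cls) :=
  Submodule.sum_mem _ fun τ _ =>
    rename_permVar_mem_multidegree K (w := d ∘ cls) (fun α => congrArg d (τ.2 α)) hP

omit [CharZero K] [DecidableEq J] [DecidableEq I] in
theorem symbolicMap_sum_classPerm [Fintype (classPerm cls)]
    (P : MvPolynomial (JordanVar (ones J)) K) :
    symbolicMap K cls d (∑ τ : classPerm cls, rename (permVar τ.1) P) =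
      (Fintype.card (classPerm cls) : K) • symbolicMap K cls d P := by
  rw [map_sum, Finset.sum_congr rfl fun τ _ => symbolicMap_rename K cls d τ.2 P, Finset.sum_const,
    Finset.card_univ, Nat.cast_smul_eq_nsmul]

theorem exists_semiInvariant_symbolicMap_eq [Fintype I] {Q : MvPolynomial (JordanVar d) K}
    (hQ : Q ∈ semiInvariants K d (classSize cls)) :
    ∃ P ∈ semiInvariants K (ones J) (d ∘ cls), symbolicMap K cls d P = Q := by
  have := Fintype.ofFinite (classPerm cls)
  obtain ⟨P, hP, rfl⟩ := exists_symbolicMap_eq K cls d hQ.1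
  have hA := sum_classPerm_mem K cls d hP
  have hs := symbolicMap_sum_classPerm K cls d P
  set A := ∑ τ : classPerm cls, rename (permVar τ.1) P with hAdef
  -- `D A` is invariant and its image is a multiple of `D_d Q = 0`, so injectivity on invariants
  -- applies.
  have hD : weitzenboeck K (ones J) A = 0 := by
    refine eq_zero_of_symbolicMap_eq_zero K cls d (weitzenboeck_mem K _ _ _ hA) (fun σ hσ => ?_) ?_
    · rw [← weitzenboeck_rename, rename_sum_classPerm K cls hσ]
    · have h0 : weitzenboeck K d (symbolicMap K cls d P) = 0 := hQ.2
      rw [symbolicMap_weitzenboeck K cls d hA, hs, Derivation.map_smul, h0, smul_zero]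
  have hc : (Fintype.card (classPerm cls) : K) ≠ 0 := Nat.cast_ne_zero.mpr Fintype.card_ne_zero
  refine ⟨(Fintype.card (classPerm cls) : K)⁻¹ • A, Submodule.smul_mem _ _ ⟨hA, hD⟩, ?_⟩
  rw [map_smul, hs, inv_smul_smul₀ hc]

end Averaging

/-! ### The kernel of the composition -/

section SymmetryRelations

variable (K : Type*) [Field K] {J I : Type*} [DecidableEq J] (cls : J → I) (d : I → ℕ)

/-- The span of the differences `P - σ P`, for `σ` moving only letters of one class. -/
noncomputable def symmetryRelations : Submodule K (MvPolynomial (BracketVar J) K) :=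
  Submodule.span K {Q | ∃ P ∈ bracketComponent K (d ∘ cls),
    ∃ (x : I) (σ : Equiv.Perm J), (∀ α, cls α ≠ x → σ α = α) ∧
      Q = P - rename (BracketVar.perm σ) P}

-- A letter of class `x` sent outside the class would share its image with a fixed letter, against
-- injectivity.
omit [DecidableEq J] in
theorem mem_classPerm_of_fixes {cls : J → I} {x : I} {σ : Equiv.Perm J}
    (h : ∀ α, cls α ≠ x → σ α = α) : σ ∈ classPerm cls := fun α => by
  by_cases hα : cls α = x
  · by_contra hc
    have := σ.injective (h (σ α) fun h' => hc (h'.trans hα.symm))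
    exact hc (congrArg cls this)
  · rw [h α hα]

/-- One-class permutations suffice by telescoping: `P - τσP = (P - σP) + (σP - τ(σP))`. -/
theorem sub_rename_mem_symmetryRelations [Fintype J] {σ : Equiv.Perm J} (hσ : σ ∈ classPerm cls)
    {P : MvPolynomial (BracketVar J) K} (hP : P ∈ bracketComponent K (d ∘ cls)) :
    P - rename (BracketVar.perm σ) P ∈ symmetryRelations K cls d := by
  refine classPerm_induction
    (p := fun σ => P - rename (BracketVar.perm σ) P ∈ symmetryRelations K cls d) ?_ ?_ hσ
  · have : BracketVar.perm (1 : Equiv.Perm J) = id := funext fun v => by cases v <;> rfl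
    rw [this, rename_id_apply, sub_self]
    exact zero_mem _
  · intro x τ σ hτ _ hσ ih
    have hm : rename (BracketVar.perm (τ * σ)) P =
        rename (BracketVar.perm τ) (rename (BracketVar.perm σ) P) := by
      rw [rename_rename]
      congr 2
      funext v
      cases v <;> rfl
    rw [hm, ← sub_add_sub_cancel]
    exact Submodule.add_mem _ ih (Submodule.subset_span ⟨_,
      rename_perm_mem_bracketComponent K (w := d ∘ cls) (fun α => congrArg d (hσ α)) hP,
      x, τ, hτ, rfl⟩)

theorem symbolicMap_chi_eq_zero_iff [CharZero K] [Fintype J]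
    {P : MvPolynomial (BracketVar J) K} (hP : P ∈ bracketComponent K (d ∘ cls)) :
    symbolicMap K cls d (chi K J P) = 0 ↔
      P ∈ (LinearMap.ker (chi K J).toLinearMap ⊓ bracketComponent K (d ∘ cls)) ⊔
        symmetryRelations K cls d := by
  constructor
  · intro h0
    have := Fintype.ofFinite (classPerm cls)
    have hc : (Fintype.card (classPerm cls) : K) ≠ 0 := Nat.cast_ne_zero.mpr Fintype.card_ne_zero
    have hχ : ∑ τ : classPerm cls, rename (permVar τ.1) (chi K J P) = 0 := by
      refine eq_zero_of_symbolicMap_eq_zero K cls d (sum_classPerm_mem K cls d (chi_mem K _ P hP).1)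
        (fun σ hσ => rename_sum_classPerm K cls hσ _) ?_
      rw [symbolicMap_sum_classPerm, h0, smul_zero]
    -- The first sum lies in `ker χ` by `hχ`, the second in the symmetry relations.
    have hdec : (Fintype.card (classPerm cls) : K) • P =
        ∑ τ : classPerm cls, rename (BracketVar.perm τ.1) P +
          ∑ τ : classPerm cls, (P - rename (BracketVar.perm τ.1) P) := by
      rw [Finset.sum_sub_distrib, add_sub_cancel, Finset.sum_const, Finset.card_univ,
        Nat.cast_smul_eq_nsmul]
    rw [← inv_smul_smul₀ hc P, hdec]
    refine Submodule.smul_mem _ _ (Submodule.add_mem_sup ⟨?_, ?_⟩ ?_)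
    · change chi K J _ = 0
      rw [map_sum, Finset.sum_congr rfl fun τ _ => chi_rename K τ.1 P, hχ]
    · exact Submodule.sum_mem _ fun τ _ =>
        rename_perm_mem_bracketComponent K (w := d ∘ cls) (fun α => congrArg d (τ.2 α)) hP
    · exact Submodule.sum_mem _ fun τ _ => sub_rename_mem_symmetryRelations K cls d τ.2 hP
  · intro h
    have hle : (LinearMap.ker (chi K J).toLinearMap ⊓ bracketComponent K (d ∘ cls)) ⊔
        symmetryRelations K cls d ≤
        LinearMap.ker (symbolicMap K cls d ∘ₗ (chi K J).toLinearMap) := by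
      refine sup_le (inf_le_left.trans fun Q hQ => ?_) (Submodule.span_le.mpr ?_)
      · change symbolicMap K cls d (chi K J Q) = 0
        rw [show chi K J Q = 0 from hQ, map_zero]
      · rintro _ ⟨Q, -, x, σ, hσ, rfl⟩
        change symbolicMap K cls d (chi K J (Q - rename (BracketVar.perm σ) Q)) = 0
        rw [map_sub, chi_rename, map_sub,
          symbolicMap_rename K cls d (mem_classPerm_of_fixes hσ), sub_self]
    exact hle h

theorem symmetryRelations_le [Fintype J] :
    symmetryRelations K cls d ≤ bracketComponent K (d ∘ cls) := by
  refine Submodule.span_le.mpr ?_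
  rintro _ ⟨P, hP, x, σ, hσ, rfl⟩
  exact Submodule.sub_mem _ hP (rename_perm_mem_bracketComponent K
    (w := d ∘ cls) (fun α => congrArg d (mem_classPerm_of_fixes hσ α)) hP)

end SymmetryRelations

end Weitzenboeck

/-! ### Assembly of the main theorem -/

theorem mainTheorem1 {K : Type*} [Field K] [CharZero K]
    {J I : Type*} [Fintype J] [DecidableEq J] [Fintype I] [DecidableEq I]
    (cls : J → I) (d : I → ℕ) :
    ∃ (Λ' : Weitzenboeck.multidegree K (Weitzenboeck.ones J) (d ∘ cls) →ₗ[K]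
          Weitzenboeck.multidegree K d (Weitzenboeck.classSize cls))
      (Λ : Weitzenboeck.semiInvariants K (Weitzenboeck.ones J) (d ∘ cls) →ₗ[K]
          Weitzenboeck.semiInvariants K d (Weitzenboeck.classSize cls)),
      -- `Λ'` is multiplicative on letters and sends `α_0 ^ (d - i) * α_1 ^ i` to `i! x_i`
      (∀ (e : J → ℕ) (he : ∀ α, e α ≤ d (cls α)),
        (Λ' ⟨Weitzenboeck.letterMonomial K (d ∘ cls) e,
            Weitzenboeck.letterMonomial_mem K (d ∘ cls) e he⟩ :
          MvPolynomial (Weitzenboeck.JordanVar d) K) =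
        ∏ α, MvPolynomial.C ((Nat.factorial (e α) : ℕ) : K) *
          MvPolynomial.X ⟨cls α, ⟨e α, Nat.lt_succ_of_le (he α)⟩⟩) ∧
      -- `Λ'` is `𝔲₂`-equivariant
      Λ' ∘ₗ Weitzenboeck.weitzenboeckOn K (Weitzenboeck.ones J) (d ∘ cls) =
        Weitzenboeck.weitzenboeckOn K d (Weitzenboeck.classSize cls) ∘ₗ Λ' ∧
      -- `Λ` is the restriction of `Λ'` to semi-invariants
      (∀ (P : Weitzenboeck.semiInvariants K (Weitzenboeck.ones J) (d ∘ cls)),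
        (Λ P : MvPolynomial (Weitzenboeck.JordanVar d) K) = Λ' ⟨P.1, P.2.1⟩) ∧
      Function.Surjective Λ ∧
      Function.Surjective (Λ ∘ₗ Weitzenboeck.chiOn K (d ∘ cls)) ∧
      (LinearMap.ker (Λ ∘ₗ Weitzenboeck.chiOn K (d ∘ cls))).map
          (Weitzenboeck.bracketComponent K (d ∘ cls)).subtype =
        (LinearMap.ker (Weitzenboeck.chi K J).toLinearMap ⊓
            Weitzenboeck.bracketComponent K (d ∘ cls)) ⊔
          Submodule.span K {Q | ∃ P ∈ Weitzenboeck.bracketComponent K (d ∘ cls),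
            ∃ (x : I) (σ : Equiv.Perm J), (∀ α, cls α ≠ x → σ α = α) ∧
              Q = P - MvPolynomial.rename (Weitzenboeck.BracketVar.perm σ) P} := by
  have hsurj : ∀ Q : Weitzenboeck.semiInvariants K d (Weitzenboeck.classSize cls),
      ∃ P ∈ Weitzenboeck.semiInvariants K (Weitzenboeck.ones J) (d ∘ cls),
        Weitzenboeck.symbolicMap K cls d P = Q :=
    fun Q => Weitzenboeck.exists_semiInvariant_symbolicMap_eq K cls d Q.2
  refine ⟨(Weitzenboeck.symbolicMap K cls d).restrict
      fun P _ => Weitzenboeck.symbolicMap_mem K cls d P,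
    (Weitzenboeck.symbolicMap K cls d).restrict fun P hP =>
      ⟨Weitzenboeck.symbolicMap_mem K cls d P, ?_⟩, ?_, ?_, ?_, ?_, ?_, ?_⟩
  · change Weitzenboeck.weitzenboeck K d (Weitzenboeck.symbolicMap K cls d P) = 0
    rw [← Weitzenboeck.symbolicMap_weitzenboeck K cls d hP.1,
      show Weitzenboeck.weitzenboeck K (Weitzenboeck.ones J) P = 0 from hP.2, map_zero]
  · intro e he
    exact (Weitzenboeck.symbolicMap_letterMonomial K cls d _ e).trans
      (Weitzenboeck.monomial_imageExp K cls d e he)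
  · exact LinearMap.ext fun P => Subtype.ext (Weitzenboeck.symbolicMap_weitzenboeck K cls d P.2)
  · exact fun P => rfl
  · intro Q
    obtain ⟨P, hP, h⟩ := hsurj Q
    exact ⟨⟨P, hP⟩, Subtype.ext h⟩
  · rw [LinearMap.coe_comp]
    refine Function.Surjective.comp (fun Q => ?_) (Weitzenboeck.chiOn_surjective K _)
    obtain ⟨P, hP, h⟩ := hsurj Q
    exact ⟨⟨P, hP⟩, Subtype.ext h⟩
  · change _ = _ ⊔ Weitzenboeck.symmetryRelations K cls d
    ext P
    constructor
    · rintro ⟨P, hP, rfl⟩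
      exact (Weitzenboeck.symbolicMap_chi_eq_zero_iff K cls d P.2).mp (congrArg Subtype.val hP)
    · intro hP
      have hmem : P ∈ Weitzenboeck.bracketComponent K (d ∘ cls) :=
        sup_le inf_le_right (Weitzenboeck.symmetryRelations_le K cls d) hP
      exact ⟨⟨P, hmem⟩, Subtype.ext
        ((Weitzenboeck.symbolicMap_chi_eq_zero_iff K cls d hmem).mpr hP), rfl⟩
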